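/- An adequate monoid is a monoid $M$ with two unary operations $x\mapsto x^+$ and $x\mapsto x^*$ such that, for all $x,y,z\in M$, \[x^+x=x,\quad (x^+y^+)^+=x^+y^+=y^+x^+,\quad (xy)^+=(xy^+)^+,\] \[x^2=x\Rightarrow x=x^+,\qquad xz=yz\Rightarrow xz^+=yz^+,\] and dually \[xx^*=x,\quad (x^*y^*)^*=x^*y^*=y^*x^*,\quad (xy)^*=(x^*y)^*,\] \[x^2=x\Rightarrow x=x^*,\qquad zx=zy\Rightarrow z^*x=z^*y.\] Morphisms of adequate monoids are the monoid morphisms preserving $+$ and $*$. Let $\mathrm{FAd}(a)$ denote the free adequate monoid on one generator $a$. Proposition. Let $\Sigma$ be a set and let $u,v$ be words in the free monoid $\Sigma^*$. Then the monoid reduct of $\mathrm{FAd}(a)$ satisfies the monoid identity $u\approx v$ (that is, $\phi(u)=\phi(v)$ for every monoid morphism $\phi\colon\Sigma^*\to\mathrm{FAd}(a)$) if and only if $u=v$. -/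

import Mathlib

/-- `p` is an operation `x ↦ x⁺` making the monoid `M` left adequate. -/
structure IsLeftAdequate (M : Type*) [Monoid M] (p : M → M) : Prop where
  plus_mul_self : ∀ x, p x * x = x
  plus_mul_plus : ∀ x y, p (p x * p y) = p x * p y
  plus_comm : ∀ x y, p x * p y = p y * p x
  plus_mul : ∀ x y, p (x * y) = p (x * p y)
  eq_plus_of_idem : ∀ x, x * x = x → x = p x
  mul_plus_of_mul : ∀ x y z, x * z = y * z → x * p z = y * p z

/-- `s` is an operation `x ↦ x^*` making the monoid `M` right adequate. -/
structure IsRightAdequate (M : Type*) [Monoid M] (s : M → M) : Prop where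
  self_mul_ast : ∀ x, x * s x = x
  ast_mul_ast : ∀ x y, s (s x * s y) = s x * s y
  ast_comm : ∀ x y, s x * s y = s y * s x
  ast_mul : ∀ x y, s (x * y) = s (s x * y)
  eq_ast_of_idem : ∀ x, x * x = x → x = s x
  ast_mul_of_mul : ∀ x y z, z * x = z * y → s z * x = s z * y

/-- (Two-sided) adequate monoids, as algebras of signature `(2,1,1,0)`. -/
class AdequateMonoid (M : Type*) extends Monoid M where
  plus : M → M
  ast : M → M
  left_adequate : IsLeftAdequate M plus
  right_adequate : IsRightAdequate M ast

/-- Morphisms of adequate monoids in the signature `(2,1,1,0)`. -/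
structure AdequateHom (M N : Type*) [AdequateMonoid M] [AdequateMonoid N] extends M →* N where
  map_plus : ∀ x, toFun (AdequateMonoid.plus x) = AdequateMonoid.plus (toFun x)
  map_ast : ∀ x, toFun (AdequateMonoid.ast x) = AdequateMonoid.ast (toFun x)

/-- Terms of signature `(2,1,1,0)` in the variables `X`. -/
inductive BiunaryTerm (X : Type*) where
  | var : X → BiunaryTerm X
  | one : BiunaryTerm X
  | mul : BiunaryTerm X → BiunaryTerm X → BiunaryTerm X
  | plus : BiunaryTerm X → BiunaryTerm X
  | ast : BiunaryTerm X → BiunaryTerm X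

namespace BiunaryTerm

/-- The least congruence on terms whose quotient satisfies the defining quasi-identities of
adequate monoids. -/
inductive Rel {X : Type*} : BiunaryTerm X → BiunaryTerm X → Prop where
  -- equivalence relation
  | refl (x) : Rel x x
  | symm {x y} : Rel x y → Rel y x
  | trans {x y z} : Rel x y → Rel y z → Rel x z
  -- compatible with the operations
  | mul_congr {x x' y y'} : Rel x x' → Rel y y' → Rel (mul x y) (mul x' y')
  | plus_congr {x x'} : Rel x x' → Rel (plus x) (plus x')
  | ast_congr {x x'} : Rel x x' → Rel (ast x) (ast x')
  -- monoid
  | mul_assoc (x y z) : Rel (mul (mul x y) z) (mul x (mul y z))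
  | one_mul (x) : Rel (mul one x) x
  | mul_one (x) : Rel (mul x one) x
  -- left adequate
  | plus_mul_self (x) : Rel (mul (plus x) x) x
  | plus_mul_plus (x y) : Rel (plus (mul (plus x) (plus y))) (mul (plus x) (plus y))
  | plus_comm (x y) : Rel (mul (plus x) (plus y)) (mul (plus y) (plus x))
  | plus_mul (x y) : Rel (plus (mul x y)) (plus (mul x (plus y)))
  | eq_plus_of_idem {x} : Rel (mul x x) x → Rel x (plus x)
  | mul_plus_of_mul {x y z} : Rel (mul x z) (mul y z) → Rel (mul x (plus z)) (mul y (plus z))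
  -- right adequate
  | self_mul_ast (x) : Rel (mul x (ast x)) x
  | ast_mul_ast (x y) : Rel (ast (mul (ast x) (ast y))) (mul (ast x) (ast y))
  | ast_comm (x y) : Rel (mul (ast x) (ast y)) (mul (ast y) (ast x))
  | ast_mul (x y) : Rel (ast (mul x y)) (ast (mul (ast x) y))
  | eq_ast_of_idem {x} : Rel (mul x x) x → Rel x (ast x)
  | ast_mul_of_mul {x y z} : Rel (mul z x) (mul z y) → Rel (mul (ast z) x) (mul (ast z) y)

instance setoid (X : Type*) : Setoid (BiunaryTerm X) :=
  ⟨Rel, Rel.refl, Rel.symm, Rel.trans⟩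

/-- The value of a term in an adequate monoid. -/
def eval {X M : Type*} [AdequateMonoid M] (f : X → M) : BiunaryTerm X → M
  | var x => f x
  | one => 1
  | mul s t => eval f s * eval f t
  | plus t => AdequateMonoid.plus (eval f t)
  | ast t => AdequateMonoid.ast (eval f t)

theorem Rel.eval_eq {X M : Type*} [AdequateMonoid M] (f : X → M) {s t : BiunaryTerm X}
    (h : Rel s t) : eval f s = eval f t := by
  have L := AdequateMonoid.left_adequate (M := M)
  have R := AdequateMonoid.right_adequate (M := M)
  induction h with
  | refl x => rfl
  | symm _ ih => exact ih.symm
  | trans _ _ h1 h2 => exact h1.trans h2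
  | mul_congr _ _ h1 h2 => simp only [eval, h1, h2]
  | plus_congr _ h1 => simp only [eval, h1]
  | ast_congr _ h1 => simp only [eval, h1]
  | mul_assoc x y z => exact _root_.mul_assoc _ _ _
  | one_mul x => exact _root_.one_mul _
  | mul_one x => exact _root_.mul_one _
  | plus_mul_self x => exact L.plus_mul_self _
  | plus_mul_plus x y => exact L.plus_mul_plus _ _
  | plus_comm x y => exact L.plus_comm _ _
  | plus_mul x y => exact L.plus_mul _ _
  | eq_plus_of_idem _ ih => exact L.eq_plus_of_idem _ ih
  | mul_plus_of_mul _ ih => exact L.mul_plus_of_mul _ _ _ ih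
  | self_mul_ast x => exact R.self_mul_ast _
  | ast_mul_ast x y => exact R.ast_mul_ast _ _
  | ast_comm x y => exact R.ast_comm _ _
  | ast_mul x y => exact R.ast_mul _ _
  | eq_ast_of_idem _ ih => exact R.eq_ast_of_idem _ ih
  | ast_mul_of_mul _ ih => exact R.ast_mul_of_mul _ _ _ ih

end BiunaryTerm

/-- The free adequate monoid freely generated by `X`: terms modulo the least congruence whose
quotient is an adequate monoid (see `FAd.existsUnique_hom` for the universal property). -/
def FAd (X : Type*) : Type _ := Quotient (BiunaryTerm.setoid X)

namespace FAd

open BiunaryTerm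

instance monoid (X : Type*) : Monoid (FAd X) where
  mul := Quotient.map₂ BiunaryTerm.mul fun _ _ h _ _ h' => Rel.mul_congr h h'
  one := Quotient.mk _ BiunaryTerm.one
  mul_assoc := by
    rintro ⟨x⟩ ⟨y⟩ ⟨z⟩
    exact Quotient.sound (Rel.mul_assoc x y z)
  one_mul := by
    rintro ⟨x⟩
    exact Quotient.sound (Rel.one_mul x)
  mul_one := by
    rintro ⟨x⟩
    exact Quotient.sound (Rel.mul_one x)

instance adequateMonoid (X : Type*) : AdequateMonoid (FAd X) where
  toMonoid := FAd.monoid X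
  plus := Quotient.map BiunaryTerm.plus fun _ _ h => Rel.plus_congr h
  ast := Quotient.map BiunaryTerm.ast fun _ _ h => Rel.ast_congr h
  left_adequate :=
    { plus_mul_self := by
        rintro ⟨x⟩
        exact Quotient.sound (Rel.plus_mul_self x)
      plus_mul_plus := by
        rintro ⟨x⟩ ⟨y⟩
        exact Quotient.sound (Rel.plus_mul_plus x y)
      plus_comm := by
        rintro ⟨x⟩ ⟨y⟩
        exact Quotient.sound (Rel.plus_comm x y)
      plus_mul := by
        rintro ⟨x⟩ ⟨y⟩
        exact Quotient.sound (Rel.plus_mul x y)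
      eq_plus_of_idem := by
        rintro ⟨x⟩ h
        exact Quotient.sound (Rel.eq_plus_of_idem (Quotient.exact h))
      mul_plus_of_mul := by
        rintro ⟨x⟩ ⟨y⟩ ⟨z⟩ h
        exact Quotient.sound (Rel.mul_plus_of_mul (Quotient.exact h)) }
  right_adequate :=
    { self_mul_ast := by
        rintro ⟨x⟩
        exact Quotient.sound (Rel.self_mul_ast x)
      ast_mul_ast := by
        rintro ⟨x⟩ ⟨y⟩
        exact Quotient.sound (Rel.ast_mul_ast x y)
      ast_comm := by
        rintro ⟨x⟩ ⟨y⟩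
        exact Quotient.sound (Rel.ast_comm x y)
      ast_mul := by
        rintro ⟨x⟩ ⟨y⟩
        exact Quotient.sound (Rel.ast_mul x y)
      eq_ast_of_idem := by
        rintro ⟨x⟩ h
        exact Quotient.sound (Rel.eq_ast_of_idem (Quotient.exact h))
      ast_mul_of_mul := by
        rintro ⟨x⟩ ⟨y⟩ ⟨z⟩ h
        exact Quotient.sound (Rel.ast_mul_of_mul (Quotient.exact h)) }

/-- The canonical generators. -/
def of {X : Type*} (x : X) : FAd X := Quotient.mk _ (BiunaryTerm.var x)

/-- The morphism out of `FAd X` determined by its values on the generators. -/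
def lift {X M : Type*} [AdequateMonoid M] (f : X → M) : AdequateHom (FAd X) M where
  toFun := Quotient.lift (eval f) fun _ _ h => Rel.eval_eq f h
  map_one' := rfl
  map_mul' := by
    rintro ⟨x⟩ ⟨y⟩
    rfl
  map_plus := by
    rintro ⟨x⟩
    rfl
  map_ast := by
    rintro ⟨x⟩
    rfl

/-- The universal property: `FAd X` is free on `X` in the class of adequate monoids. -/
theorem existsUnique_hom {X M : Type*} [AdequateMonoid M] (f : X → M) :
    ∃! φ : AdequateHom (FAd X) M, ∀ x, φ.toMonoidHom (of x) = f x := by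
  refine ⟨lift f, fun _ => rfl, ?_⟩
  intro φ hφ
  have key : ∀ t : BiunaryTerm X, φ.toMonoidHom (Quotient.mk _ t) = eval f t := by
    intro t
    induction t with
    | var x => exact hφ x
    | one => exact φ.toMonoidHom.map_one
    | mul s t hs ht =>
      refine (φ.toMonoidHom.map_mul (Quotient.mk _ s) (Quotient.mk _ t)).trans ?_
      rw [hs, ht]
      rfl
    | plus t ht =>
      refine (φ.map_plus (Quotient.mk _ t)).trans ?_
      exact congrArg AdequateMonoid.plus ht
    | ast t ht =>
      refine (φ.map_ast (Quotient.mk _ t)).trans ?_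
      exact congrArg AdequateMonoid.ast ht
  have e : φ.toMonoidHom = (lift f).toMonoidHom := by
    ext x
    obtain ⟨t, rfl⟩ := Quotient.exists_rep x
    exact key t
  cases φ
  cases h : lift f
  simp_all

/-- `X` embeds in `FAd X` (the free monoid is adequate with all `x⁺` and `x^*` equal to `1`). -/
theorem of_injective (X : Type*) : Function.Injective (of : X → FAd X) := by
  have one_of_idem : ∀ x : FreeMonoid X, x * x = x → x = 1 := fun x h =>
    mul_left_cancel (a := x) (by rw [h, mul_one])
  let _ : AdequateMonoid (FreeMonoid X) :=
    { plus := fun _ => 1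
      ast := fun _ => 1
      left_adequate := ⟨by simp, by simp, by simp, by simp, one_of_idem, by
        intro x y z h
        rw [mul_right_cancel h]⟩
      right_adequate := ⟨by simp, by simp, by simp, by simp, one_of_idem, by
        intro x y z h
        rw [mul_left_cancel h]⟩ }
  intro x y h
  exact FreeMonoid.of_injective (congrArg (lift (FreeMonoid.of (α := X))).toMonoidHom h)

end FAd

/-- The monoid `M` satisfies the monoid identity `u ≈ v` over the alphabet `S`. -/
def SatisfiesMonoidIdentity (M : Type*) [Monoid M] {S : Type*} (u v : FreeMonoid S) : Prop :=
  ∀ φ : FreeMonoid S →* M, φ u = φ v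

/-! A substitution into $\mathrm{FAd}(a)$ can detect whether the letter at position $i$ of a word is
$s$. Send $s$ to $ea$ and every other letter to $a$, where $e=(a(a^{i+2})^*)^+$. To see the effect,
map $\mathrm{FAd}(a)$ to relations on the vertices of a digraph, with $a$ the edge relation and
$^+$, $^*$ the partial identities on domain and range. All relations on a set violate the
cancellation quasi-identities, but they hold (`mul_dom_rel_of_mul_eq`, `ran_mul_rel_of_mul_eq`) once
relations carry degrees and walks are unique for given length and end points. In the digraph
`twoRays` with the edge `inl i → inr 0` deleted, $e$ fails on the forward ray exactly at `inl i`
(`mark_rel_inl`). Hence the image of $w$ relates `inl 0` to `inl |w|` exactly when the letter of $w$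
at position $i$ is not $s$ (`twoRaysHom_markLetter_rel`). Degrees give $|u|=|v|$, so $u$ and $v$
agree letter by letter. -/

/-- A family of relations `P n`, to be thought of as "there is a walk of length `n` from `x` to
`y`", such that walks compose and a walk is determined by its length and its end points. -/
structure WalkSystem (V : Type*) where
  P : ℕ → V → V → Prop
  zero_iff : ∀ x y, P 0 x y ↔ x = y
  comp : ∀ {m n x y z}, P m x y → P n y z → P (m + n) x z
  unique : ∀ {m n x y y' z}, P m x y → P n y z → P m x y' → P n y' z → y = y'

/-! ### The adequate monoid of graded relations -/

/-- A relation on `V` of degree `n`, contained in the walks of length `n`. -/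
@[ext]
structure GradedRel {V : Type*} (W : WalkSystem V) where
  deg : ℕ
  rel : V → V → Prop
  le : ∀ x y, rel x y → W.P deg x y

namespace GradedRel

variable {V : Type*} {W : WalkSystem V}

theorem ext_iff_rel {R T : GradedRel W} :
    R = T ↔ R.deg = T.deg ∧ ∀ x y, R.rel x y ↔ T.rel x y :=
  ⟨by rintro rfl; simp, fun h => GradedRel.ext h.1 (by ext x y; exact h.2 x y)⟩

/-- Composition of relations, with addition of degrees. -/
instance : Monoid (GradedRel W) where
  mul R T := ⟨R.deg + T.deg, fun x z => ∃ y, R.rel x y ∧ T.rel y z,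
    fun _ _ ⟨_, h, h'⟩ => W.comp (R.le _ _ h) (T.le _ _ h')⟩
  one := ⟨0, fun x y => x = y, fun x y h => (W.zero_iff x y).2 h⟩
  mul_assoc R T U := ext_iff_rel.2 ⟨Nat.add_assoc _ _ _, fun x y =>
    ⟨fun ⟨z, ⟨w, h, h'⟩, h''⟩ => ⟨w, h, z, h', h''⟩,
      fun ⟨w, h, z, h', h''⟩ => ⟨z, ⟨w, h, h'⟩, h''⟩⟩⟩
  one_mul R := ext_iff_rel.2 ⟨Nat.zero_add _, fun x y =>
    ⟨by rintro ⟨_, rfl, h⟩; exact h, fun h => ⟨x, rfl, h⟩⟩⟩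
  mul_one R := ext_iff_rel.2 ⟨Nat.add_zero _, fun x y =>
    ⟨by rintro ⟨_, h, rfl⟩; exact h, fun h => ⟨y, h, rfl⟩⟩⟩

@[simp] theorem deg_one : (1 : GradedRel W).deg = 0 := rfl

@[simp] theorem deg_mul (R T : GradedRel W) : (R * T).deg = R.deg + T.deg := rfl

@[simp] theorem rel_one {x y : V} : (1 : GradedRel W).rel x y ↔ x = y := Iff.rfl

@[simp] theorem rel_mul {R T : GradedRel W} {x z : V} :
    (R * T).rel x z ↔ ∃ y, R.rel x y ∧ T.rel y z := Iff.rfl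

/-- The partial identity on the domain. -/
def dom (R : GradedRel W) : GradedRel W :=
  ⟨0, fun x y => x = y ∧ ∃ z, R.rel x z, fun x y h => (W.zero_iff x y).2 h.1⟩

/-- The partial identity on the range. -/
def ran (R : GradedRel W) : GradedRel W :=
  ⟨0, fun x y => x = y ∧ ∃ z, R.rel z x, fun x y h => (W.zero_iff x y).2 h.1⟩

@[simp] theorem deg_dom (R : GradedRel W) : R.dom.deg = 0 := rfl

@[simp] theorem deg_ran (R : GradedRel W) : R.ran.deg = 0 := rfl

@[simp] theorem rel_dom {R : GradedRel W} {x y : V} :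
    R.dom.rel x y ↔ x = y ∧ ∃ z, R.rel x z := Iff.rfl

@[simp] theorem rel_ran {R : GradedRel W} {x y : V} :
    R.ran.rel x y ↔ x = y ∧ ∃ z, R.rel z x := Iff.rfl

theorem deg_eq_zero_of_idem {R : GradedRel W} (h : R * R = R) : R.deg = 0 := by
  have := congrArg deg h
  simp only [deg_mul] at this
  omega

theorem eq_of_rel_of_deg_eq_zero {R : GradedRel W} (h : R.deg = 0) {x y : V} (hr : R.rel x y) :
    x = y :=
  (W.zero_iff x y).1 (h ▸ R.le x y hr)

/-- Extending $(x,y)\in R$ by a pair $(y,z)\in U$ gives a walk from $x$ to $z$ that also factors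
through $T$ and $U$. The degrees of $R$ and $T$ agree, so `W.unique` forces both factorisations to
have the same midpoint. -/
theorem mul_dom_rel_of_mul_eq {R T U : GradedRel W} (h : R * U = T * U) {x y : V}
    (hr : (R * U.dom).rel x y) : (T * U.dom).rel x y := by
  obtain ⟨_, hxy, rfl, z, hz⟩ := hr
  have hd : R.deg = T.deg := by simpa using congrArg deg h
  obtain ⟨y', h1, h2⟩ := ((ext_iff_rel.1 h).2 x z).1 ⟨_, hxy, hz⟩
  obtain rfl := W.unique (R.le _ _ hxy) (U.le _ _ hz) (hd ▸ T.le _ _ h1) (U.le _ _ h2)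
  exact ⟨_, h1, rfl, z, hz⟩

theorem ran_mul_rel_of_mul_eq {R T U : GradedRel W} (h : U * R = U * T) {x y : V}
    (hr : (U.ran * R).rel x y) : (U.ran * T).rel x y := by
  obtain ⟨_, ⟨rfl, z, hz⟩, hxy⟩ := hr
  have hd : R.deg = T.deg := by simpa using congrArg deg h
  obtain ⟨x', h1, h2⟩ := ((ext_iff_rel.1 h).2 z y).1 ⟨_, hz, hxy⟩
  obtain rfl := W.unique (U.le _ _ hz) (R.le _ _ hxy) (U.le _ _ h1) (hd ▸ T.le _ _ h2)
  exact ⟨_, ⟨rfl, z, hz⟩, h2⟩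

theorem isLeftAdequate : IsLeftAdequate (GradedRel W) dom where
  plus_mul_self R := by
    rw [ext_iff_rel]
    simp only [deg_mul, deg_dom, rel_mul, rel_dom]
    grind
  plus_mul_plus R T := by
    rw [ext_iff_rel]
    simp only [deg_mul, deg_dom, rel_mul, rel_dom]
    grind
  plus_comm R T := by
    rw [ext_iff_rel]
    simp only [deg_mul, deg_dom, rel_mul, rel_dom]
    grind
  plus_mul R T := by
    rw [ext_iff_rel]
    simp only [deg_dom, rel_mul, rel_dom]
    grind
  eq_plus_of_idem R h := by
    have h0 := deg_eq_zero_of_idem h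
    refine ext_iff_rel.2 ⟨h0, fun x y => ⟨fun hr => ⟨eq_of_rel_of_deg_eq_zero h0 hr, y, hr⟩, ?_⟩⟩
    rintro ⟨rfl, z, hz⟩
    obtain rfl := eq_of_rel_of_deg_eq_zero h0 hz
    exact hz
  mul_plus_of_mul R T U h :=
    ext_iff_rel.2 ⟨by simpa using congrArg deg h, fun _ _ =>
      ⟨mul_dom_rel_of_mul_eq h, mul_dom_rel_of_mul_eq h.symm⟩⟩

theorem isRightAdequate : IsRightAdequate (GradedRel W) ran where
  self_mul_ast R := by
    rw [ext_iff_rel]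
    simp only [deg_mul, deg_ran, rel_mul, rel_ran]
    grind
  ast_mul_ast R T := by
    rw [ext_iff_rel]
    simp only [deg_mul, deg_ran, rel_mul, rel_ran]
    grind
  ast_comm R T := by
    rw [ext_iff_rel]
    simp only [deg_mul, deg_ran, rel_mul, rel_ran]
    grind
  ast_mul R T := by
    rw [ext_iff_rel]
    simp only [deg_ran, rel_mul, rel_ran]
    grind
  eq_ast_of_idem R h := by
    have h0 := deg_eq_zero_of_idem h
    refine ext_iff_rel.2 ⟨h0, fun x y => ⟨fun hr => ?_, ?_⟩⟩
    · obtain rfl := eq_of_rel_of_deg_eq_zero h0 hr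
      exact ⟨rfl, x, hr⟩
    · rintro ⟨rfl, z, hz⟩
      obtain rfl := eq_of_rel_of_deg_eq_zero h0 hz
      exact hz
  ast_mul_of_mul R T U h :=
    ext_iff_rel.2 ⟨by simpa using congrArg deg h, fun _ _ =>
      ⟨ran_mul_rel_of_mul_eq h, ran_mul_rel_of_mul_eq h.symm⟩⟩

instance : AdequateMonoid (GradedRel W) where
  plus := dom
  ast := ran
  left_adequate := isLeftAdequate
  right_adequate := isRightAdequate

end GradedRel

/-! ### The two-ray digraph and the marking idempotent -/

/-- Walks in the digraph with a forward ray `inl 0 → inl 1 → ⋯`, a backward ray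
`⋯ → inr 1 → inr 0`, and edges from the forward ray to `inr 0`. -/
def twoRays : WalkSystem (ℕ ⊕ ℕ) where
  P
    | n, .inl j, .inl k => k = j + n
    -- No edge leaves `inr 0`, so a walk crosses over only in its last step; this keeps walks
    -- unique.
    | n, .inl _, .inr k => k = 0 ∧ 0 < n
    | _, .inr _, .inl _ => False
    | n, .inr j, .inr k => j = k + n
  zero_iff := by
    rintro (x | x) (y | y) <;> simp [eq_comm]
  comp := by
    rintro m n (x | x) (y | y) (z | z) <;> grind
  unique := by
    rintro m n (x | x) (y | y) (y' | y') (z | z) <;> grind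

/-- The edges of the two rays, together with the edges `inl j → inr 0` for `j ≠ i`. -/
def twoRaysEdge (i : ℕ) : GradedRel twoRays where
  deg := 1
  rel
    | .inl j, .inl k => k = j + 1
    | .inl j, .inr k => k = 0 ∧ j ≠ i
    | .inr _, .inl _ => False
    | .inr j, .inr k => j = k + 1
  le := by
    rintro (x | x) (y | y) <;> simp +contextual [twoRays]

theorem twoRaysEdge_pow_deg (i l : ℕ) : (twoRaysEdge i ^ l).deg = l := by
  induction l with
  | zero => rfl
  | succ l ih => rw [pow_succ, GradedRel.deg_mul, ih, twoRaysEdge]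

/-- The forward ray starts at `inl 0` and cannot be entered from the other ray, so walks ending at
`inl k` have length at most `k`. In contrast, `inr 0` ends walks of every length. -/
theorem twoRaysEdge_pow_rel_inl {i l : ℕ} {x : ℕ ⊕ ℕ} {k : ℕ}
    (h : (twoRaysEdge i ^ l).rel x (.inl k)) : l ≤ k := by
  have := (twoRaysEdge i ^ l).le _ _ h
  rw [twoRaysEdge_pow_deg] at this
  rcases x with x | x
  · change k = x + l at this
    omega
  · exact this.elim

theorem twoRaysEdge_pow_rel_inr (i l : ℕ) : (twoRaysEdge i ^ l).rel (.inr l) (.inr 0) := by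
  induction l with
  | zero => rfl
  | succ l ih => exact pow_succ' (twoRaysEdge i) l ▸ ⟨.inr l, rfl, ih⟩

/-- The marking idempotent `(a (a ^ (i + 2))^*)⁺`. -/
def FAd.mark (i : ℕ) : FAd Unit :=
  AdequateMonoid.plus (FAd.of () * AdequateMonoid.ast (FAd.of () ^ (i + 2)))

/-- The morphism sending the generator to the edge relation of the two rays. -/
def twoRaysHom (i : ℕ) : AdequateHom (FAd Unit) (GradedRel twoRays) :=
  FAd.lift fun _ => twoRaysEdge i

theorem twoRaysHom_of (i : ℕ) : (twoRaysHom i).toMonoidHom (FAd.of ()) = twoRaysEdge i := rfl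

theorem twoRaysHom_mark (i : ℕ) : (twoRaysHom i).toMonoidHom (FAd.mark i) =
    (twoRaysEdge i * (twoRaysEdge i ^ (i + 2)).ran).dom := by
  have h1 : ∀ x, (twoRaysHom i).toMonoidHom (AdequateMonoid.plus x) =
    ((twoRaysHom i).toMonoidHom x).dom := (twoRaysHom i).map_plus
  have h2 : ∀ x, (twoRaysHom i).toMonoidHom (AdequateMonoid.ast x) =
    ((twoRaysHom i).toMonoidHom x).ran := (twoRaysHom i).map_ast
  rw [FAd.mark, h1, map_mul, h2, map_pow, twoRaysHom_of]

/-- The marking idempotent holds at all vertices of the forward ray but `inl i`. -/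
theorem mark_rel_inl {i j : ℕ} {y : ℕ ⊕ ℕ} :
    ((twoRaysHom i).toMonoidHom (FAd.mark i)).rel (.inl j) y ↔ .inl j = y ∧ j ≠ i := by
  rw [twoRaysHom_mark]
  refine and_congr_right fun _ => ⟨?_, fun h => ?_⟩
  · rintro ⟨_, k | k, h1, rfl, _, h2⟩
    -- Here `i + 2 ≤ k = j + 1`, so `j > i`: the exponent `i + 2` is the least one that excludes
    -- `inl (i + 1)`, the only successor of `inl i`.
    · have := twoRaysEdge_pow_rel_inl h2
      change k = j + 1 at h1
      omega
    · exact h1.2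
  · exact ⟨.inr 0, .inr 0, ⟨rfl, h⟩, rfl, _, twoRaysEdge_pow_rel_inr i (i + 2)⟩

/-! ### Reading off the letters of a word -/

open Classical in
/-- The morphism sending the letter `s` to the marked generator and the other letters to the
generator. -/
noncomputable def markLetter {S : Type*} (s : S) (i : ℕ) : FreeMonoid S →* FAd Unit :=
  FreeMonoid.lift fun t => if t = s then FAd.mark i * FAd.of () else FAd.of ()

theorem twoRaysHom_markLetter_of_rel {S : Type*} {s t : S} {i j : ℕ} {y : ℕ ⊕ ℕ} :
    ((twoRaysHom i).toMonoidHom (markLetter s i (FreeMonoid.of t))).rel (.inl j) y ↔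
      (twoRaysEdge i).rel (.inl j) y ∧ (t = s → j ≠ i) := by
  rw [markLetter, FreeMonoid.lift_eval_of]
  split_ifs with h
  · rw [map_mul, twoRaysHom_of, GradedRel.rel_mul]
    simp only [mark_rel_inl, h]
    grind
  · simp [h, twoRaysHom_of]

theorem deg_twoRaysHom_markLetter {S : Type*} (s : S) (i : ℕ) (w : FreeMonoid S) :
    ((twoRaysHom i).toMonoidHom (markLetter s i w)).deg = w.length := by
  induction w using FreeMonoid.inductionOn' with
  | one => simp
  | of_mul t w ih =>
    have : ((twoRaysHom i).toMonoidHom (markLetter s i (FreeMonoid.of t))).deg = 1 := by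
      rw [markLetter, FreeMonoid.lift_eval_of]
      split_ifs
      · rw [map_mul, twoRaysHom_of, twoRaysHom_mark]
        rfl
      · rfl
    rw [map_mul, map_mul, GradedRel.deg_mul, this, ih]
    simp

/-- A word holds along the forward ray if and only if its letter at the position of the vertex
`inl i` is not the marked letter. -/
theorem twoRaysHom_markLetter_rel {S : Type*} (s : S) (i j : ℕ) (w : FreeMonoid S) :
    ((twoRaysHom i).toMonoidHom (markLetter s i w)).rel (.inl j) (.inl (j + w.length)) ↔
      ∀ k, w.toList[k]? = some s → j + k ≠ i := by
  induction w using FreeMonoid.inductionOn' generalizing j with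
  | one => simp
  | of_mul t w ih =>
    rw [map_mul, map_mul, GradedRel.rel_mul]
    simp only [twoRaysHom_markLetter_of_rel]
    have key : (∀ k, (FreeMonoid.of t * w).toList[k]? = some s → j + k ≠ i) ↔
        (t = s → j ≠ i) ∧ ∀ k, w.toList[k]? = some s → j + 1 + k ≠ i := by
      refine ⟨fun h => ⟨fun e => ?_, fun k hk => ?_⟩, fun h k hk => ?_⟩
      · exact h 0 (by simp [e])
      · have := h (k + 1) (by simpa using hk)
        omega
      · cases k with
        | zero => exact h.1 (by simpa using hk)
        | succ k =>
          have := h.2 k (by simpa using hk)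
          omega
    have hl : j + (FreeMonoid.of t * w).length = j + 1 + w.length := by
      rw [FreeMonoid.length_mul, FreeMonoid.length_of]
      omega
    rw [key, ← ih (j + 1), hl]
    constructor
    · rintro ⟨k | k, ⟨h1, h2⟩, h3⟩
      · obtain rfl : k = j + 1 := h1
        exact ⟨h2, h3⟩
      -- A walk that has left the forward ray never returns to it.
      · exact (GradedRel.le _ _ _ h3).elim
    · rintro ⟨h2, h3⟩
      exact ⟨.inl (j + 1), ⟨rfl, h2⟩, h3⟩

theorem mainTheorem7 {S : Type*} (u v : FreeMonoid S) :
    SatisfiesMonoidIdentity (FAd Unit) u v ↔ u = v := by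
  refine ⟨fun h => ?_, by rintro rfl φ; rfl⟩
  have agree : ∀ (s : S) (i : ℕ), u.toList[i]? = some s ↔ v.toList[i]? = some s := by
    intro s i
    have hr := congrArg (twoRaysHom i).toMonoidHom (h (markLetter s i))
    have hd : u.length = v.length := by
      simpa only [deg_twoRaysHom_markLetter] using congrArg GradedRel.deg hr
    -- Starting at `inl 0`, the vertex index equals the position in the word; `hd` makes the end
    -- vertices for `u` and `v` coincide.
    have hu := twoRaysHom_markLetter_rel s i 0 u
    have hv := twoRaysHom_markLetter_rel s i 0 v
    rw [hr, hd, hv] at hu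
    grind
  apply FreeMonoid.toList.injective
  apply List.ext_getElem?
  intro i
  exact Option.ext fun s => agree s i
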